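/- Let $A\ge 1$ be the number of actions, $\mathcal A=\{1,\dots,A\}$, let $\mathcal X\subseteq\mathbb R^k$ be a non-empty covariate space, $\sigma_a>0$ for $a\in\mathcal A$, $\underline q\in(0,1]$, and let $T\in\mathbb N$ with $T\ge A-1$. A bandit $\nu=(\nu_a)_{a\in\mathcal A}$ assigns to each action $a$ a probability law $\nu_a$ of a triple $(R_a,C_a,\mathbf X_a)\in\mathbb R\times\{0,1\}\times\mathcal X$ (reward, indicator that the reward is not missing, covariates). Write $\theta_a=\mathbb E_\nu[R_a]$, $\theta_a(\mathbf X_a)=\mathbb E_\nu[R_a\mid\mathbf X_a]$ and $q_a(\mathbf X_a)=\mathbb E_\nu[C_a\mid\mathbf X_a]$. Let $\mathcal C$ be the class of bandits such that, for every $a$, $\theta_a$ is finite, $R_a-\theta_a$ is sub-Gaussian with variance proxy $\sigma_a^2$ (i.e. $\mathbb E\,e^{\lambda(R_a-\theta_a)}\le e^{\lambda^2\sigma_a^2/2}$ for all $\lambda\in\mathbb R$), and $C_a\sim\mathrm{Be}(q_a)$ for some $q_a\in(0,1]$. * $\mathcal C_1$ (reward-independent missingness) is the class of $\nu\in\mathcal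 C$ such that $C_a$ and $R_a$ are independent for every $a$. * $\mathcal C_2$ (reward-dependent missingness) is the class of $\nu\in\mathcal C$ such that for every $a$: either $\mathbb E_\nu[R_a\mid\mathbf X_a,C_a]=\mathbb E_\nu[R_a\mid\mathbf X_a]$ a.s. or $\mathbb E_\nu[C_a\mid\mathbf X_a,R_a]=\mathbb E_\nu[C_a\mid\mathbf X_a]$ a.s.; $R_a-\theta_a(\mathbf X_a)$ is sub-Gaussian with variance proxy $\sigma_a^2$ conditionally on $\mathbf X_a$; $\theta_a(\mathbf X_a)$ is a.s. bounded; and $q_a(\mathbf X_a)\in[\underline q,1]$ a.s. A policy $\pi\in\Pi$ is a sequence of (measurable) maps $\pi_t$ from the history $(A_\ell,R_{A_\ell,\ell},C_{A_\ell,\ell},\mathbf X_{A_\ell,\ell})_{\ell<t}$ to probability distributions on $\mathcal A$; in round $t$ the action $A_t$ is drawn from $\pi_t$, and then the triple of round $t$ is drawn from $\nu_{A_t}$. The (expected) regret is $\mathsf{Regret}_T(\pi;\nu)=\mathbb E_{\pi,\nu}\big[\sum_{t=1}^T(\max_{a}\theta_a-\theta_{A_t})\big]$, and the minimax regret over a class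 $\mathcal D$ of bandits is $\mathsf{Regret}^\star_T(\mathcal D)=\inf_{\pi\in\Pi}\sup_{\nu\in\mathcal D}\mathsf{Regret}_T(\pi;\nu)\in[-\infty,+\infty]$. Then, for $j\in\{1,2\}$, $$\mathsf{Regret}^\star_T(\mathcal C_j)\ \ge\ \frac{\sqrt{T(A-1)}}{16\sqrt e}.$$ Moreover, if $\sigma_a\ge1$ for all $a$, the same lower bound holds for the minimax regret over the subclass of those $\nu\in\mathcal C_j$ with $\theta_a(\mathbf X_a)\in[0,1]$ a.s. for all $a\in\mathcal A$. -/

import Mathlib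

open MeasureTheory ProbabilityTheory

namespace MissingBandit

/-- One outcome `(R, C, X)` of pulling an action: the reward `R`, the indicator `C` that the
reward is not missing, and the covariates `X`, which take values in `𝒳 ⊆ ℝᵏ`. -/
abbrev Outcome {k : ℕ} (𝒳 : Set (EuclideanSpace ℝ (Fin k))) : Type := ℝ × Bool × 𝒳

section Outcomes

variable {k : ℕ} {𝒳 : Set (EuclideanSpace ℝ (Fin k))}

/-- The reward `R`. -/
def rew (z : Outcome 𝒳) : ℝ := z.1

/-- The indicator `C` of not being missing. -/
def obs (z : Outcome 𝒳) : Bool := z.2.1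

/-- The indicator `C`, as a real number in `{0, 1}`. -/
def obsReal (z : Outcome 𝒳) : ℝ := if obs z then 1 else 0

/-- The covariates `X`. -/
def cov (z : Outcome 𝒳) : 𝒳 := z.2.2

/-- The σ-algebra generated by `X`. -/
abbrev sigmaX (𝒳 : Set (EuclideanSpace ℝ (Fin k))) : MeasurableSpace (Outcome 𝒳) :=
  MeasurableSpace.comap cov inferInstance

/-- The σ-algebra generated by `(X, C)`. -/
abbrev sigmaXC (𝒳 : Set (EuclideanSpace ℝ (Fin k))) : MeasurableSpace (Outcome 𝒳) :=
  MeasurableSpace.comap (fun z => (cov z, obs z)) inferInstance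

/-- The σ-algebra generated by `(X, R)`. -/
abbrev sigmaXR (𝒳 : Set (EuclideanSpace ℝ (Fin k))) : MeasurableSpace (Outcome 𝒳) :=
  MeasurableSpace.comap (fun z => (cov z, rew z)) inferInstance

end Outcomes

/-! ### Bandits and classes of bandits -/

/-- A bandit with `A` actions: the law `ν a` of `(R_a, C_a, X_a)` for each action `a`. -/
abbrev Bandit (A : ℕ) {k : ℕ} (𝒳 : Set (EuclideanSpace ℝ (Fin k))) : Type :=
  Fin A → ProbabilityMeasure (Outcome 𝒳)

section Classes

variable {k A : ℕ} {𝒳 : Set (EuclideanSpace ℝ (Fin k))}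

/-- The mean reward `θ_a` of action `a`. -/
noncomputable def meanReward (ν : Bandit A 𝒳) (a : Fin A) : ℝ :=
  ∫ z, rew z ∂(ν a : Measure (Outcome 𝒳))

/-- The best mean reward. -/
noncomputable def bestMean (ν : Bandit A 𝒳) : ℝ := ⨆ a, meanReward ν a

/-- The conditional mean reward `θ_a(X_a) = E[R_a | X_a]`. -/
noncomputable def condMeanReward (ν : Bandit A 𝒳) (a : Fin A) : Outcome 𝒳 → ℝ :=
  (ν a : Measure (Outcome 𝒳))[rew | sigmaX 𝒳]

/-- The conditional probability `q_a(X_a) = E[C_a | X_a]` that the reward is not missing. -/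
noncomputable def condObsProb (ν : Bandit A 𝒳) (a : Fin A) : Outcome 𝒳 → ℝ :=
  (ν a : Measure (Outcome 𝒳))[obsReal | sigmaX 𝒳]

/-- The class `𝒞` of all bandits with missing rewards: `R_a` has a finite mean and is
sub-Gaussian (after centering) with variance proxy `σ_a ^ 2`, and `C_a ∼ Be(q_a)` for some
`q_a ∈ (0, 1]`. -/
def classC (𝒳 : Set (EuclideanSpace ℝ (Fin k))) (σ : Fin A → ℝ) : Set (Bandit A 𝒳) :=
  {ν | ∀ a, Integrable rew (ν a : Measure (Outcome 𝒳)) ∧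
    HasSubgaussianMGF (fun z => rew z - meanReward ν a) (Real.toNNReal (σ a ^ 2))
      (ν a : Measure (Outcome 𝒳)) ∧
    ∃ q : unitInterval, 0 < q ∧
      (ν a : Measure (Outcome 𝒳)).map obs = bernoulliMeasure true false q}

/-- The class `𝒞₁` of bandits with reward-independent missingness: `C_a` is independent of
`R_a`. -/
def classC₁ (𝒳 : Set (EuclideanSpace ℝ (Fin k))) (σ : Fin A → ℝ) : Set (Bandit A 𝒳) :=
  {ν | ν ∈ classC 𝒳 σ ∧ ∀ a, IndepFun rew obs (ν a : Measure (Outcome 𝒳))}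

/-- Model-based ignorability: `E[R_a | X_a, C_a] = E[R_a | X_a]` almost surely. -/
def ModelBased (ν : Bandit A 𝒳) (a : Fin A) : Prop :=
  (ν a : Measure (Outcome 𝒳))[rew | sigmaXC 𝒳] =ᵐ[(ν a : Measure (Outcome 𝒳))]
    condMeanReward ν a

/-- Design-based ignorability: `E[C_a | X_a, R_a] = E[C_a | X_a]` almost surely. -/
def DesignBased (ν : Bandit A 𝒳) (a : Fin A) : Prop :=
  (ν a : Measure (Outcome 𝒳))[obsReal | sigmaXR 𝒳] =ᵐ[(ν a : Measure (Outcome 𝒳))]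
    condObsProb ν a

/-- Conditionally on `X_a`, the reward `R_a` is sub-Gaussian (after centering at `E[R_a | X_a]`)
with variance proxy `s ^ 2`. -/
def CondSubgaussian (ν : Bandit A 𝒳) (a : Fin A) (s : ℝ) : Prop :=
  ∀ t : ℝ,
    Integrable (fun z => Real.exp (t * (rew z - condMeanReward ν a z)))
      (ν a : Measure (Outcome 𝒳)) ∧
    ∀ᵐ z ∂(ν a : Measure (Outcome 𝒳)),
      ((ν a : Measure (Outcome 𝒳))[fun z => Real.exp (t * (rew z - condMeanReward ν a z)) |
        sigmaX 𝒳]) z ≤ Real.exp (t ^ 2 * s ^ 2 / 2)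

/-- The class `𝒞₂` of bandits with reward-dependent missingness: each action is model-based or
design-based ignorable, its reward is conditionally sub-Gaussian with a bounded conditional mean,
and `q_a(X_a) ∈ [qmin, 1]`. -/
def classC₂ (𝒳 : Set (EuclideanSpace ℝ (Fin k))) (σ : Fin A → ℝ) (qmin : ℝ) :
    Set (Bandit A 𝒳) :=
  {ν | ν ∈ classC 𝒳 σ ∧ ∀ a,
    (ModelBased ν a ∨ DesignBased ν a) ∧
    CondSubgaussian ν a (σ a) ∧
    (∃ K : ℝ, ∀ᵐ z ∂(ν a : Measure (Outcome 𝒳)), |condMeanReward ν a z| ≤ K) ∧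
    ∀ᵐ z ∂(ν a : Measure (Outcome 𝒳)), condObsProb ν a z ∈ Set.Icc qmin 1}

/-- The bandits all of whose conditional mean rewards lie in `[0, 1]`. -/
def unitMeans (A : ℕ) (𝒳 : Set (EuclideanSpace ℝ (Fin k))) : Set (Bandit A 𝒳) :=
  {ν | ∀ a, ∀ᵐ z ∂(ν a : Measure (Outcome 𝒳)), condMeanReward ν a z ∈ Set.Icc (0 : ℝ) 1}

end Classes

/-! ### Policies, the law of the history, and regret -/

/-- What is recorded in one round: the chosen action and its outcome. -/
abbrev Round (A : ℕ) {k : ℕ} (𝒳 : Set (EuclideanSpace ℝ (Fin k))) : Type := Fin A × Outcome 𝒳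

/-- A policy: given the history of the first `t` rounds, a probability distribution for the next
action. (For a horizon `T`, only the values at `t < T` matter.) -/
structure Policy (A : ℕ) {k : ℕ} (𝒳 : Set (EuclideanSpace ℝ (Fin k))) where
  /-- the conditional law of the action after `t` rounds -/
  act : (t : ℕ) → Kernel (Fin t → Round A 𝒳) (Fin A)
  /-- it is a probability distribution -/
  isMarkov : ∀ t, IsMarkovKernel (act t)

section Regret

variable {k A : ℕ} {𝒳 : Set (EuclideanSpace ℝ (Fin k))}

instance (π : Policy A 𝒳) (t : ℕ) : IsMarkovKernel (π.act t) := π.isMarkov t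

/-- The bandit as a kernel from actions to outcomes. -/
def outcomeKernel (ν : Bandit A 𝒳) : Kernel (Fin A) (Outcome 𝒳) :=
  Kernel.ofFunOfCountable fun a => (ν a : Measure (Outcome 𝒳))

instance (ν : Bandit A 𝒳) : IsMarkovKernel (outcomeKernel ν) :=
  ⟨fun a => inferInstanceAs (IsProbabilityMeasure (ν a : Measure (Outcome 𝒳)))⟩

/-- The conditional law of the round that follows a history of length `t`: draw the action `a`
from the policy, then the outcome from `ν a`. -/
noncomputable def roundKernel (π : Policy A 𝒳) (ν : Bandit A 𝒳) (t : ℕ) :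
    Kernel (Fin t → Round A 𝒳) (Round A 𝒳) :=
  (π.act t) ⊗ₖ Kernel.prodMkLeft (Fin t → Round A 𝒳) (outcomeKernel ν)

/-- Append a round to a history. -/
def append (t : ℕ) (p : (Fin t → Round A 𝒳) × Round A 𝒳) : Fin (t + 1) → Round A 𝒳 :=
  Fin.snoc (α := fun _ => Round A 𝒳) p.1 p.2

/-- The law of the history of the first `t` rounds when `π` is played on `ν`. -/
noncomputable def historyLaw (π : Policy A 𝒳) (ν : Bandit A 𝒳) :
    (t : ℕ) → Measure (Fin t → Round A 𝒳)
  | 0 => Measure.dirac Fin.elim0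
  | t + 1 => ((historyLaw π ν t) ⊗ₘ (roundKernel π ν t)).map (append t)

theorem measurable_append (t : ℕ) :
    Measurable (append t : (Fin t → Round A 𝒳) × Round A 𝒳 → Fin (t + 1) → Round A 𝒳) := by
  refine measurable_pi_lambda _ fun i => ?_
  refine Fin.lastCases ?_ (fun j => ?_) i
  · simpa [append] using measurable_snd
  · simpa [append, Function.comp_def] using
      (measurable_pi_apply (X := fun _ : Fin t => Round A 𝒳) j).comp measurable_fst

instance (π : Policy A 𝒳) (ν : Bandit A 𝒳) (t : ℕ) : IsMarkovKernel (roundKernel π ν t) := by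
  unfold roundKernel
  infer_instance

instance instIsProbabilityMeasureHistoryLaw (π : Policy A 𝒳) (ν : Bandit A 𝒳) (t : ℕ) :
    IsProbabilityMeasure (historyLaw π ν t) := by
  induction t with
  | zero => unfold historyLaw; infer_instance
  | succ t ih =>
    unfold historyLaw
    exact Measure.isProbabilityMeasure_map (measurable_append t).aemeasurable

/-- The expected (pseudo-)regret over `T` rounds. -/
noncomputable def regret (T : ℕ) (π : Policy A 𝒳) (ν : Bandit A 𝒳) : ℝ :=
  ∫ h, ∑ t : Fin T, (bestMean ν - meanReward ν (h t).1) ∂(historyLaw π ν T)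

/-- The minimax regret over a class of bandits, as an extended real number. -/
noncomputable def minimaxRegret (T : ℕ) (𝒞 : Set (Bandit A 𝒳)) : EReal :=
  ⨅ π : Policy A 𝒳, ⨆ ν ∈ 𝒞, (regret T π ν : EReal)

end Regret

end MissingBandit

namespace MissingBandit

/-! ### Conditional expectations with respect to an almost surely constant variable -/

/-! Missing data only enlarges the classes. Take bandits whose reward is always observed (`C = 1`),
whose covariates are a fixed point `x`, and whose rewards are Gaussian. Since `(C, X)` is almost
surely constant, it is independent of everything, so every conditional requirement in `classC₁` and
`classC₂` collapses to an unconditional one. It remains to bound the regret from below for ordinary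
Gaussian bandits.

With unrestricted means and at least two actions, one round suffices: a policy plays some action `a`
first with probability `p > 0`, and giving another action mean `B / p` forces regret at least `B`.
So the minimax regret is infinite, whatever the `σ a` are.

With means in `[0, 1]` and `σ a ≥ 1`, unit-variance Gaussians and a two-point argument are used. In
`ν` one action `b` has mean `δ`, the others `0`. By pigeonhole some `i ≠ b` is played at most `T /
(A - 1)` times on average, and `ν'` raises its mean to `2δ`. The law of the history under `ν'` has
an explicit density with respect to that under `ν` (`historyLaw_eq_withDensity`). The expected
log-likelihood ratio is `-2δ²` times the expected count of `i` (`integral_sum_rounds`), hence at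
least `-1/2` for `δ = √((A - 1) / T) / 2`. The histories are then too similar for the policy to
favour `b` under `ν` and avoid it under `ν'` (`mul_add_integral_le_of_withDensity`), so one of the
two regrets is at least `√(T (A - 1)) / 12`. -/

theorem condExp_comap_of_ae_eq_const {Ω β : Type*} {mΩ : MeasurableSpace Ω}
    [mβ : MeasurableSpace β] {μ : Measure Ω} [IsProbabilityMeasure μ] {f : Ω → ℝ} {g : Ω → β}
    (hf : Measurable f) (hg : Measurable g) {c : β} (hc : g =ᵐ[μ] fun _ => c) :
    μ[f | MeasurableSpace.comap g mβ] =ᵐ[μ] fun _ => ∫ x, f x ∂μ := by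
  have h : IndepFun f g μ :=
    (indepFun_const_right f c).congr (Filter.EventuallyEq.refl _ _) hc.symm
  exact condExp_indep_eq hf.comap_le hg.comap_le (comap_measurable f).stronglyMeasurable h

/-! ### Bandits with Gaussian rewards and no missingness -/

section Gaussian

variable {k A : ℕ} {𝒳 : Set (EuclideanSpace ℝ (Fin k))}

theorem measurable_rew : Measurable (rew : Outcome 𝒳 → ℝ) := measurable_fst

theorem measurable_obs : Measurable (obs : Outcome 𝒳 → Bool) := measurable_snd.fst

theorem measurable_cov : Measurable (cov : Outcome 𝒳 → 𝒳) := measurable_snd.snd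

theorem measurable_obsReal : Measurable (obsReal : Outcome 𝒳 → ℝ) :=
  (measurable_of_finite (fun b : Bool => if b then (1 : ℝ) else 0)).comp measurable_obs

/-- The outcome with reward `r` that is observed, with covariates `x`. -/
def observedOutcome (x : 𝒳) (r : ℝ) : Outcome 𝒳 := (r, true, x)

theorem measurable_observedOutcome (x : 𝒳) : Measurable (observedOutcome x) :=
  measurable_id.prodMk measurable_const

/-- The law of an always observed Gaussian reward with constant covariates `x`. -/
noncomputable def gaussianOutcome (x : 𝒳) (m : ℝ) (v : NNReal) : Measure (Outcome 𝒳) :=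
  (gaussianReal m v).map (observedOutcome x)

instance (x : 𝒳) (m : ℝ) (v : NNReal) : IsProbabilityMeasure (gaussianOutcome x m v) :=
  Measure.isProbabilityMeasure_map (measurable_observedOutcome x).aemeasurable

/-- The bandit with always observed Gaussian rewards and constant covariates `x`. -/
noncomputable def gaussianBandit (x : 𝒳) (m : Fin A → ℝ) (v : Fin A → NNReal) : Bandit A 𝒳 :=
  fun a => ⟨gaussianOutcome x (m a) (v a), inferInstance⟩

variable (x : 𝒳) (m : ℝ) (v : NNReal)

theorem map_rew_gaussianOutcome :
    (gaussianOutcome x m v).map rew = gaussianReal m v := by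
  rw [gaussianOutcome, Measure.map_map measurable_rew (measurable_observedOutcome x)]
  exact Measure.map_id

theorem integrable_rew_gaussianOutcome : Integrable rew (gaussianOutcome x m v) := by
  have h : Integrable id (gaussianReal m v) := (memLp_id_gaussianReal 1).integrable (by simp)
  rw [← map_rew_gaussianOutcome x] at h
  exact h.comp_measurable measurable_rew

theorem integral_rew_gaussianOutcome : ∫ z, rew z ∂(gaussianOutcome x m v) = m := by
  have h := integral_id_gaussianReal (μ := m) (v := v)
  rwa [← map_rew_gaussianOutcome x, integral_map measurable_rew.aemeasurable (by fun_prop)] at h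

theorem hasSubgaussianMGF_rew_sub_gaussianOutcome :
    HasSubgaussianMGF (fun z => rew z - m) v (gaussianOutcome x m v) := by
  refine ⟨fun t => ?_, fun t => ?_⟩
  · have h : Integrable (fun r => Real.exp (t * r)) (gaussianReal m v) :=
      integrable_exp_mul_gaussianReal t
    rw [← map_rew_gaussianOutcome x] at h
    refine ((h.comp_measurable measurable_rew).const_mul (Real.exp (-(t * m)))).congr ?_
    refine .of_forall fun z => ?_
    simp only [Function.comp_apply, ← Real.exp_add]
    ring_nf
  · rw [mgf_gaussianReal (μ := 0) (v := v)]
    · simp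
    · have h : (fun z : Outcome 𝒳 => rew z - m) = (fun r => r - m) ∘ rew := rfl
      rw [h, ← Measure.map_map (by fun_prop) measurable_rew, map_rew_gaussianOutcome,
        gaussianReal_map_sub_const, sub_self]

/-- Only the reward is random in `gaussianOutcome`. This triviality of `(C, X)` is what verifies all
the conditional assumptions. -/
theorem map_ae_eq_const_gaussianOutcome {β : Type*} [MeasurableSpace β]
    [MeasurableSingletonClass β] {f : Bool × 𝒳 → β} (hf : Measurable f) :
    (fun z : Outcome 𝒳 => f z.2) =ᵐ[gaussianOutcome x m v] fun _ => f (true, x) := by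
  have hs : MeasurableSet {z : Outcome 𝒳 | f z.2 = f (true, x)} :=
    (hf.comp measurable_snd) (measurableSet_singleton _)
  refine (ae_map_iff (measurable_observedOutcome x).aemeasurable hs).2 (.of_forall fun r => ?_)
  rfl

/-- Completing the square, `-(r - d)² / 2 = -r² / 2 + (d r - d² / 2)`; the constant coordinates `C`
and `X` contribute nothing to the likelihood ratio. -/
theorem gaussianOutcome_eq_withDensity (d : ℝ) :
    gaussianOutcome x d 1 = (gaussianOutcome x 0 1).withDensity
      (fun z => ENNReal.ofReal (Real.exp (d * rew z - d ^ 2 / 2))) := by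
  have hg : Measurable fun r : ℝ => ENNReal.ofReal (Real.exp (d * r - d ^ 2 / 2)) := by fun_prop
  have h : gaussianReal d 1 = (gaussianReal 0 1).withDensity
      (fun r => ENNReal.ofReal (Real.exp (d * r - d ^ 2 / 2))) := by
    rw [gaussianReal_of_var_ne_zero _ one_ne_zero, gaussianReal_of_var_ne_zero _ one_ne_zero,
      ← withDensity_mul _ (measurable_gaussianPDF _ _) hg]
    congr 1
    ext r
    simp only [Pi.mul_apply, gaussianPDF, gaussianPDFReal]
    rw [← ENNReal.ofReal_mul (by positivity), mul_assoc _ (Real.exp _), ← Real.exp_add]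
    congr 3
    push_cast
    ring
  ext s hs
  rw [gaussianOutcome, h, Measure.map_apply (measurable_observedOutcome x) hs,
    withDensity_apply _ (measurable_observedOutcome x hs), withDensity_apply _ hs, gaussianOutcome,
    setLIntegral_map hs (f := fun z => ENNReal.ofReal (Real.exp (d * rew z - d ^ 2 / 2)))
      (hg.comp measurable_rew) (measurable_observedOutcome x)]
  rfl

end Gaussian

/-! ### Membership of the Gaussian bandits in the classes -/

section GaussianClasses

variable {k A : ℕ} {𝒳 : Set (EuclideanSpace ℝ (Fin k))} (x : 𝒳) (m : Fin A → ℝ)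
  (v : Fin A → NNReal)

theorem coe_gaussianBandit (a : Fin A) :
    (gaussianBandit x m v a : Measure (Outcome 𝒳)) = gaussianOutcome x (m a) (v a) := rfl

theorem meanReward_gaussianBandit (a : Fin A) : meanReward (gaussianBandit x m v) a = m a :=
  integral_rew_gaussianOutcome x (m a) (v a)

theorem condMeanReward_gaussianBandit (a : Fin A) :
    condMeanReward (gaussianBandit x m v) a =ᵐ[gaussianOutcome x (m a) (v a)] fun _ => m a := by
  refine (condExp_comap_of_ae_eq_const measurable_rew measurable_cov
    (map_ae_eq_const_gaussianOutcome x (m a) (v a) measurable_snd)).trans ?_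
  rw [integral_rew_gaussianOutcome]

theorem gaussianBandit_mem_classC {σ : Fin A → ℝ} (hv : ∀ a, (v a : ℝ) ≤ σ a ^ 2) :
    gaussianBandit x m v ∈ classC 𝒳 σ := by
  intro a
  rw [meanReward_gaussianBandit, coe_gaussianBandit]
  have hsub := hasSubgaussianMGF_rew_sub_gaussianOutcome x (m a) (v a)
  refine ⟨integrable_rew_gaussianOutcome x _ _,
    ⟨hsub.integrable_exp_mul, fun t => (hsub.mgf_le t).trans ?_⟩, 1, one_pos, ?_⟩
  · rw [Real.coe_toNNReal _ (sq_nonneg _)]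
    gcongr
    exact hv a
  · rw [bernoulliMeasure_one, gaussianOutcome,
      Measure.map_map measurable_obs (measurable_observedOutcome x)]
    change Measure.map (fun _ => true) _ = _
    rw [Measure.map_const, measure_univ, one_smul]

theorem gaussianBandit_mem_classC₁ {σ : Fin A → ℝ} (hv : ∀ a, (v a : ℝ) ≤ σ a ^ 2) :
    gaussianBandit x m v ∈ classC₁ 𝒳 σ :=
  ⟨gaussianBandit_mem_classC x m v hv, fun a =>
    IndepFun.congr (indepFun_const_right rew true) (Filter.EventuallyEq.refl _ _)
      (map_ae_eq_const_gaussianOutcome x (m a) (v a) measurable_fst).symm⟩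

theorem gaussianBandit_mem_classC₂ {σ : Fin A → ℝ} (hv : ∀ a, (v a : ℝ) ≤ σ a ^ 2) {q : ℝ}
    (hq : q ≤ 1) : gaussianBandit x m v ∈ classC₂ 𝒳 σ q := by
  refine ⟨gaussianBandit_mem_classC x m v hv, fun a => ?_⟩
  have hmean := condMeanReward_gaussianBandit x m v a
  have hsub := hasSubgaussianMGF_rew_sub_gaussianOutcome x (m a) (v a)
  have hcov := map_ae_eq_const_gaussianOutcome x (m a) (v a) measurable_snd
  -- Model-based ignorability is the chosen alternative: conditioning on `X` or on `(X, C)` gives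
  -- the same constant `m a`.
  refine ⟨Or.inl ?_, fun t => ?_, ⟨|m a|, ?_⟩, ?_⟩
  · refine Filter.EventuallyEq.trans ?_ hmean.symm
    refine (condExp_comap_of_ae_eq_const measurable_rew (measurable_cov.prodMk measurable_obs)
      (map_ae_eq_const_gaussianOutcome x (m a) (v a) (f := fun p => (p.2, p.1))
        measurable_swap)).trans ?_
    rw [integral_rew_gaussianOutcome]
  · have hcongr : (fun z => Real.exp (t * (rew z - condMeanReward (gaussianBandit x m v) a z)))
        =ᵐ[gaussianOutcome x (m a) (v a)] fun z => Real.exp (t * (rew z - m a)) := by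
      filter_upwards [hmean] with z hz
      rw [hz]
    refine ⟨(hsub.integrable_exp_mul t).congr hcongr.symm, ?_⟩
    have hmeas : Measurable fun z : Outcome 𝒳 => Real.exp (t * (rew z - m a)) := by
      have := measurable_rew (𝒳 := 𝒳)
      fun_prop
    filter_upwards [(condExp_congr_ae (m := sigmaX 𝒳) hcongr).trans
      (condExp_comap_of_ae_eq_const hmeas measurable_cov hcov)] with z hz
    rw [coe_gaussianBandit, hz]
    refine (hsub.mgf_le t).trans (Real.exp_le_exp.2 ?_)
    nlinarith [mul_le_mul_of_nonneg_right (hv a) (sq_nonneg t)]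
  · filter_upwards [hmean] with z hz
    rw [hz]
  · have hobs := map_ae_eq_const_gaussianOutcome x (m a) (v a)
      (f := fun p => if p.1 then (1 : ℝ) else 0)
      ((measurable_of_finite (fun b : Bool => if b then (1 : ℝ) else 0)).comp measurable_fst)
    have hint : ∫ z, obsReal z ∂(gaussianOutcome x (m a) (v a)) = 1 := by
      refine (integral_congr_ae (g := fun _ => (1 : ℝ)) hobs).trans ?_
      simp
    filter_upwards [condExp_comap_of_ae_eq_const measurable_obsReal measurable_cov hcov] with z hz
    have hz' : condObsProb (gaussianBandit x m v) a z = 1 := hz.trans hint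
    rw [hz']
    exact ⟨hq, le_rfl⟩

theorem gaussianBandit_mem_unitMeans (hm : ∀ a, m a ∈ Set.Icc (0 : ℝ) 1) :
    gaussianBandit x m v ∈ unitMeans A 𝒳 := by
  intro a
  filter_upwards [condMeanReward_gaussianBandit x m v a] with z hz
  rw [hz]
  exact hm a

end GaussianClasses

/-! ### The law of the history -/

section History

variable {k A : ℕ} {𝒳 : Set (EuclideanSpace ℝ (Fin k))} (π : Policy A 𝒳) (ν : Bandit A 𝒳)

theorem lintegral_roundKernel (t : ℕ) (h : Fin t → Round A 𝒳) {f : Round A 𝒳 → ENNReal}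
    (hf : Measurable f) :
    ∫⁻ r, f r ∂(roundKernel π ν t h) =
      ∫⁻ a, ∫⁻ z, f (a, z) ∂(ν a : Measure (Outcome 𝒳)) ∂(π.act t h) := by
  rw [roundKernel, Kernel.lintegral_compProd _ _ _ hf]
  rfl

theorem lintegral_historyLaw_succ (t : ℕ) {f : (Fin (t + 1) → Round A 𝒳) → ENNReal}
    (hf : Measurable f) :
    ∫⁻ h, f h ∂(historyLaw π ν (t + 1)) =
      ∫⁻ h, ∫⁻ r, f (append t (h, r)) ∂(roundKernel π ν t h) ∂(historyLaw π ν t) := by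
  rw [historyLaw, lintegral_map hf (measurable_append t),
    Measure.lintegral_compProd (f := fun p => f (append t p)) (hf.comp (measurable_append t))]

@[simp]
theorem append_castSucc (t : ℕ) (p : (Fin t → Round A 𝒳) × Round A 𝒳) (i : Fin t) :
    append t p i.castSucc = p.1 i := by
  simp [append]

@[simp]
theorem append_last (t : ℕ) (p : (Fin t → Round A 𝒳) × Round A 𝒳) :
    append t p (Fin.last t) = p.2 := by
  simp [append]

/-- Appending later rounds does not alter round `0`, whose action is drawn before any outcome; hence
its law is the same for all bandits. -/
theorem lintegral_first_action (t : ℕ) (f : Fin A → ENNReal) :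
    ∫⁻ h, f (h 0).1 ∂(historyLaw π ν (t + 1)) = ∫⁻ a, f a ∂(π.act 0 Fin.elim0) := by
  have hf : Measurable f := measurable_of_finite f
  have hmeas (t : ℕ) : Measurable fun h : Fin (t + 1) → Round A 𝒳 => f (h 0).1 :=
    hf.comp (measurable_pi_apply (0 : Fin (t + 1))).fst
  induction t with
  | zero =>
    rw [lintegral_historyLaw_succ π ν 0 (hmeas 0), historyLaw]
    have h0 (h : Fin 0 → Round A 𝒳) : ∫⁻ r, f (append 0 (h, r) 0).1 ∂(roundKernel π ν 0 h) =
        ∫⁻ a, f a ∂(π.act 0 Fin.elim0) := by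
      rw [Subsingleton.elim h Fin.elim0]
      have h1 (r : Round A 𝒳) : append 0 (Fin.elim0, r) 0 = r := append_last 0 (Fin.elim0, r)
      simp_rw [h1]
      simpa using lintegral_roundKernel π ν 0 Fin.elim0 (hf.comp measurable_fst)
    simp_rw [h0]
    simp
  | succ t ih =>
    rw [lintegral_historyLaw_succ π ν (t + 1) (hmeas _), ← ih]
    refine lintegral_congr fun h => ?_
    have h0 (r : Round A 𝒳) : append (t + 1) (h, r) 0 = h 0 := append_castSucc (t + 1) (h, r) 0
    simp [h0]

theorem measurable_round {t : ℕ} (i : Fin t) : Measurable fun h : Fin t → Round A 𝒳 => h i :=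
  measurable_pi_apply i

/-- The integrand factors through the finite set of action sequences. -/
theorem integrable_actions (t : ℕ) (F : (Fin t → Fin A) → ℝ) :
    Integrable (fun h => F fun i => (h i).1) (historyLaw π ν t) := by
  have hm : Measurable fun (h : Fin t → Round A 𝒳) (i : Fin t) => (h i).1 :=
    measurable_pi_lambda _ fun i => (measurable_round i).fst
  have : IsFiniteMeasure ((historyLaw π ν t).map fun h i => (h i).1) :=
    Measure.isFiniteMeasure_map _ _
  exact (Integrable.of_finite (f := F)).comp_measurable hm

theorem integrable_roundKernel (t : ℕ) {g : Round A 𝒳 → ℝ} (hg : Measurable g)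
    (hint : ∀ a, Integrable (fun z => g (a, z)) (ν a : Measure (Outcome 𝒳)))
    (h : Fin t → Round A 𝒳) : Integrable g (roundKernel π ν t h) := by
  rw [roundKernel, ProbabilityTheory.integrable_compProd_iff hg.aestronglyMeasurable]
  exact ⟨.of_forall hint, Integrable.of_finite⟩

theorem integral_roundKernel (t : ℕ) {g : Round A 𝒳 → ℝ} (hg : Measurable g)
    (hint : ∀ a, Integrable (fun z => g (a, z)) (ν a : Measure (Outcome 𝒳)))
    (h : Fin t → Round A 𝒳) :
    ∫ r, g r ∂(roundKernel π ν t h) =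
      ∫ a, ∫ z, g (a, z) ∂(ν a : Measure (Outcome 𝒳)) ∂(π.act t h) := by
  have := integrable_roundKernel π ν t hg hint h
  rw [roundKernel] at this ⊢
  rw [ProbabilityTheory.integral_compProd this]
  rfl

theorem integrable_comp_snd_history (t : ℕ) {g : Round A 𝒳 → ℝ} (hg : Measurable g)
    (hint : ∀ a, Integrable (fun z => g (a, z)) (ν a : Measure (Outcome 𝒳))) :
    Integrable (fun p => g p.2) ((historyLaw π ν t) ⊗ₘ (roundKernel π ν t)) := by
  rw [Measure.integrable_compProd_iff (f := fun p => g p.2)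
    (hg.comp measurable_snd).aestronglyMeasurable]
  refine ⟨.of_forall fun h => integrable_roundKernel π ν t hg hint h, ?_⟩
  simp_rw [integral_roundKernel π ν t hg.norm (fun a => (hint a).norm)]
  have hm : StronglyMeasurable fun h : Fin t → Round A 𝒳 =>
      ∫ a, ∫ z, ‖g (a, z)‖ ∂(ν a : Measure (Outcome 𝒳)) ∂(π.act t h) :=
    (measurable_of_finite _).stronglyMeasurable.integral_kernel
  -- There are finitely many actions, so the sum of their `L¹` norms bounds the conditional norm
  -- uniformly in the history.
  refine Integrable.of_bound hm.aestronglyMeasurable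
    (∑ a, ∫ z, ‖g (a, z)‖ ∂(ν a : Measure (Outcome 𝒳))) (.of_forall fun h => ?_)
  refine (norm_integral_le_of_norm_le_const (μ := π.act t h) (.of_forall fun a => ?_)).trans_eq
    (by rw [probReal_univ, mul_one])
  rw [Real.norm_of_nonneg (integral_nonneg fun z => norm_nonneg _)]
  exact Finset.single_le_sum
    (f := fun a => ∫ z, ‖g (a, z)‖ ∂(ν a : Measure (Outcome 𝒳)))
    (fun a _ => integral_nonneg fun z => norm_nonneg _) (Finset.mem_univ a)

theorem integrable_sum_rounds (t : ℕ) {g : Round A 𝒳 → ℝ} (hg : Measurable g)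
    (hint : ∀ a, Integrable (fun z => g (a, z)) (ν a : Measure (Outcome 𝒳))) :
    Integrable (fun h => ∑ i : Fin t, g (h i)) (historyLaw π ν t) := by
  induction t with
  | zero => simp
  | succ t ih =>
    have hm : Measurable fun h : Fin (t + 1) → Round A 𝒳 => ∑ i, g (h i) :=
      Finset.measurable_sum _ fun i _ => hg.comp (measurable_round i)
    rw [historyLaw, integrable_map_measure hm.aestronglyMeasurable
      (measurable_append t).aemeasurable]
    simp only [Function.comp_def, Fin.sum_univ_castSucc, append_castSucc, append_last]
    refine Integrable.add ?_ (integrable_comp_snd_history π ν t hg hint)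
    rw [← Measure.fst_compProd (historyLaw π ν t) (roundKernel π ν t)] at ih
    exact ih.comp_measurable measurable_fst

/-- Given the past and the chosen action, the outcome is a fresh draw from that action's law.
Applied to the log-likelihood ratio of a round, this is the divergence decomposition: relative
entropy accumulates in proportion to the expected action counts. -/
theorem integral_sum_rounds (t : ℕ) {g : Round A 𝒳 → ℝ} (hg : Measurable g)
    (hint : ∀ a, Integrable (fun z => g (a, z)) (ν a : Measure (Outcome 𝒳))) :
    ∫ h, ∑ i : Fin t, g (h i) ∂(historyLaw π ν t) =
      ∫ h, ∑ i : Fin t, ∫ z, g ((h i).1, z) ∂(ν (h i).1 : Measure (Outcome 𝒳))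
        ∂(historyLaw π ν t) := by
  have hstep (g : Round A 𝒳 → ℝ) (hg : Measurable g)
      (hint : ∀ a, Integrable (fun z => g (a, z)) (ν a : Measure (Outcome 𝒳))) (t : ℕ) :
      ∫ h, ∑ i : Fin (t + 1), g (h i) ∂(historyLaw π ν (t + 1)) =
        ∫ h, ∑ i : Fin t, g (h i) ∂(historyLaw π ν t) +
          ∫ h, ∫ a, ∫ z, g (a, z) ∂(ν a : Measure (Outcome 𝒳)) ∂(π.act t h)
            ∂(historyLaw π ν t) := by
    have hm (t : ℕ) : Measurable fun h : Fin t → Round A 𝒳 => ∑ i, g (h i) :=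
      Finset.measurable_sum _ fun i _ => hg.comp (measurable_round i)
    have ih := integrable_sum_rounds π ν t hg hint
    rw [← Measure.fst_compProd (historyLaw π ν t) (roundKernel π ν t)] at ih
    have hsnd := integrable_comp_snd_history π ν t hg hint
    rw [historyLaw, integral_map (measurable_append t).aemeasurable
      (hm (t + 1)).aestronglyMeasurable]
    simp only [Fin.sum_univ_castSucc, append_castSucc, append_last]
    rw [integral_add (f := fun p => ∑ i, g (p.1 i)) (ih.comp_measurable measurable_fst) hsnd,
      Measure.integral_compProd hsnd]
    simp_rw [integral_roundKernel π ν t hg hint]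
    congr 1
    conv_rhs => rw [← Measure.fst_compProd (historyLaw π ν t) (roundKernel π ν t), Measure.fst,
      integral_map measurable_fst.aemeasurable (hm t).aestronglyMeasurable]
  induction t with
  | zero => simp
  | succ t ih =>
    -- `g` and its average over outcomes have the same one-round increment, since averaging a second
    -- time changes nothing.
    rw [hstep g hg hint, ih, hstep (fun r => ∫ z, g (r.1, z) ∂(ν r.1 : Measure (Outcome 𝒳)))
      ((measurable_of_finite fun a => ∫ z, g (a, z) ∂(ν a : Measure (Outcome 𝒳))).comp
        measurable_fst) (fun a => integrable_const (∫ z, g (a, z) ∂(ν a : Measure (Outcome 𝒳))))]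
    simp

/-- Change of measure between two bandits: the likelihood ratio of a history is the product of the
likelihood ratios of its rounds. -/
theorem historyLaw_eq_withDensity {ν ν' : Bandit A 𝒳} {ℓ : Round A 𝒳 → ENNReal}
    (hℓ : Measurable ℓ)
    (hν : ∀ a, (ν' a : Measure (Outcome 𝒳)) =
      (ν a : Measure (Outcome 𝒳)).withDensity fun z => ℓ (a, z)) (t : ℕ) :
    historyLaw π ν' t = (historyLaw π ν t).withDensity fun h => ∏ i, ℓ (h i) := by
  have hm (t : ℕ) : Measurable fun h : Fin t → Round A 𝒳 => ∏ i, ℓ (h i) :=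
    Finset.measurable_prod _ fun i _ => hℓ.comp (measurable_round i)
  induction t with
  | zero => simp [historyLaw]
  | succ t ih =>
    refine Measure.ext_of_lintegral _ fun f hf => ?_
    have hfa : Measurable fun p : (Fin t → Round A 𝒳) × Round A 𝒳 => f (append t p) :=
      hf.comp (measurable_append t)
    rw [lintegral_withDensity_eq_lintegral_mul _ (hm _) hf,
      lintegral_historyLaw_succ π ν' t hf, lintegral_historyLaw_succ π ν t ((hm _).mul hf), ih,
      lintegral_withDensity_eq_lintegral_mul _ (hm t) hfa.lintegral_kernel_prod_right']
    refine lintegral_congr fun h => ?_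
    have hfh : Measurable fun r => f (append t (h, r)) := hfa.comp measurable_prodMk_left
    simp only [Pi.mul_apply, Fin.prod_univ_castSucc, append_castSucc, append_last, mul_assoc]
    have hℓf : Measurable fun r => ℓ r * f (append t (h, r)) := hℓ.mul hfh
    rw [lintegral_const_mul _ hℓf, lintegral_roundKernel π ν' t h hfh,
      lintegral_roundKernel π ν t h hℓf]
    congr 1
    refine lintegral_congr fun a => ?_
    rw [hν a, lintegral_withDensity_eq_lintegral_mul (f := fun z => ℓ (a, z))
      (g := fun z => f (append t (h, (a, z)))) _ (hℓ.comp measurable_prodMk_left)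
      (hfh.comp measurable_prodMk_left)]
    rfl

/-- The best mean dominates that of any competitor `b`, so gaps to a convenient `b` suffice and
`bestMean` need not be computed. -/
theorem integral_sum_actions_le_regret (T : ℕ) (g : Fin A → ℝ) (b : Fin A)
    (hg : ∀ a, g a ≤ meanReward ν b - meanReward ν a) :
    ∫ h, ∑ t : Fin T, g (h t).1 ∂(historyLaw π ν T) ≤ regret T π ν := by
  refine integral_mono (integrable_actions π ν T fun s => ∑ t, g (s t))
    (integrable_actions π ν T fun s => ∑ t, (bestMean ν - meanReward ν (s t))) fun h => ?_
  refine Finset.sum_le_sum fun t _ => (hg _).trans ?_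
  gcongr
  exact le_ciSup (Set.finite_range _).bddAbove b

end History

/-! ### Two bandits that are hard to tell apart -/

/-- With `u = exp (y / 2)` and `y ≤ 2 (u - 1)`, the two cases reduce to `(u - 2)² ≥ 0` and `(2u -
1)² ≥ 0`. Integrated for a log-likelihood ratio `y`, it bounds the overlap of two laws below by a
linear function of the relative entropy. -/
theorem three_add_two_mul_sub_exp_le (y : ℝ) :
    3 + 2 * y - Real.exp y ≤ 3 * min 1 (Real.exp y) := by
  have hu : y / 2 + 1 ≤ Real.exp (y / 2) := Real.add_one_le_exp _
  have hy : Real.exp y = Real.exp (y / 2) ^ 2 := by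
    rw [← Real.exp_nat_mul]
    congr 1
    push_cast
    ring
  rcases le_total 1 (Real.exp y) with h | h
  · rw [min_eq_left h]
    nlinarith [sq_nonneg (Real.exp (y / 2) - 2)]
  · rw [min_eq_right h]
    nlinarith [sq_nonneg (2 * Real.exp (y / 2) - 1)]

/-- A testing lower bound: if `μ' = e ^ Y • μ`, then no `[0, T]`-valued variable is small under
`μ'` and close to `T` under `μ`, unless the relative entropy `-E[Y]` is large. -/
theorem mul_add_integral_le_of_withDensity {Ω : Type*} {mΩ : MeasurableSpace Ω}
    {μ μ' : Measure Ω} [IsProbabilityMeasure μ] [IsProbabilityMeasure μ'] {Y n : Ω → ℝ}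
    (hYm : Measurable Y) (hY : Integrable Y μ)
    (hμ : μ' = μ.withDensity fun ω => ENNReal.ofReal (Real.exp (Y ω)))
    (hn : Measurable n) {T : ℝ} (hn0 : ∀ ω, 0 ≤ n ω) (hnT : ∀ ω, n ω ≤ T) :
    T * (2 + 2 * ∫ ω, Y ω ∂μ) / 3 ≤ ∫ ω, (T - n ω) ∂μ + ∫ ω, n ω ∂μ' := by
  have hd : Measurable fun ω => ENNReal.ofReal (Real.exp (Y ω)) := by fun_prop
  have hfin : ∀ᵐ ω ∂μ, ENNReal.ofReal (Real.exp (Y ω)) < ⊤ :=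
    .of_forall fun ω => ENNReal.ofReal_lt_top
  have hint (F : Ω → ℝ) : ∫ ω, F ω ∂μ' = ∫ ω, Real.exp (Y ω) * F ω ∂μ := by
    rw [hμ, integral_withDensity_eq_integral_toReal_smul hd hfin]
    simp [ENNReal.toReal_ofReal (Real.exp_pos _).le]
  have hintegrable {F : Ω → ℝ} (hF : Integrable F μ') :
      Integrable (fun ω => Real.exp (Y ω) * F ω) μ := by
    rw [hμ, integrable_withDensity_iff_integrable_smul' hd hfin] at hF
    simpa [ENNReal.toReal_ofReal (Real.exp_pos _).le] using hF
  have hbound (ω : Ω) : ‖n ω‖ ≤ T := by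
    rw [Real.norm_of_nonneg (hn0 ω)]
    exact hnT ω
  have hnμ : Integrable n μ := .of_bound hn.aestronglyMeasurable T (.of_forall hbound)
  have hnμ' : Integrable n μ' := .of_bound hn.aestronglyMeasurable T (.of_forall hbound)
  have hexp : Integrable (fun ω => Real.exp (Y ω)) μ := by
    simpa using hintegrable (integrable_const (1 : ℝ))
  have hexp1 : ∫ ω, Real.exp (Y ω) ∂μ = 1 := by
    have := hint fun _ => 1
    simpa using this.symm
  have hlin : Integrable (fun ω => 3 + 2 * Y ω) μ := (integrable_const _).add (hY.const_mul 2)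
  have hsub : Integrable (fun ω => T - n ω) μ := (integrable_const T).sub hnμ
  have hleft : ∫ ω, T * (3 + 2 * Y ω - Real.exp (Y ω)) / 3 ∂μ =
      T * (2 + 2 * ∫ ω, Y ω ∂μ) / 3 := by
    rw [integral_div, integral_const_mul,
      integral_sub hlin hexp,
      integral_add (integrable_const _) (hY.const_mul 2), integral_const_mul, hexp1]
    simp only [integral_const, probReal_univ, smul_eq_mul]
    ring
  rw [hint, ← integral_add hsub (hintegrable hnμ'), ← hleft]
  refine integral_mono (((hlin.sub hexp).const_mul T).div_const 3)
    (hsub.add (hintegrable hnμ')) fun ω => ?_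
  -- The weights `T - n` and `n` are nonnegative with sum `T`, so `(T - n) + exp Y * n ≥ T * min 1
  -- (exp Y)`.
  have h := three_add_two_mul_sub_exp_le (Y ω)
  have hT : 0 ≤ T := (hn0 ω).trans (hnT ω)
  change T * (3 + 2 * Y ω - Real.exp (Y ω)) / 3 ≤ (T - n ω) + Real.exp (Y ω) * n ω
  have h1 := mul_le_mul_of_nonneg_left h hT
  have h2 := mul_le_mul_of_nonneg_left (min_le_left 1 (Real.exp (Y ω))) (sub_nonneg.2 (hnT ω))
  have h3 := mul_le_mul_of_nonneg_left (min_le_right 1 (Real.exp (Y ω))) (hn0 ω)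
  linarith

/-! ### Lower bounds on the regret of a fixed policy, and passage to the minimax regret -/

section LowerBound

variable {k : ℕ} {𝒳 : Set (EuclideanSpace ℝ (Fin k))}

/-- With unbounded mean rewards, already the first round can be arbitrarily expensive. -/
theorem exists_gaussianBandit_le_regret {A T : ℕ} (hA : 2 ≤ A) (hT : 1 ≤ T) (x : 𝒳)
    (v : Fin A → NNReal) (π : Policy A 𝒳) {B : ℝ} (hB : 0 ≤ B) :
    ∃ m : Fin A → ℝ, B ≤ regret T π (gaussianBandit x m v) := by
  obtain ⟨t, rfl⟩ : ∃ t, T = t + 1 := ⟨T - 1, by omega⟩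
  have : Nontrivial (Fin A) := Fin.nontrivial_iff_two_le.2 hA
  obtain ⟨a, ha⟩ : ∃ a : Fin A, π.act 0 Fin.elim0 {a} ≠ 0 := by
    by_contra! h
    have h1 : π.act 0 Fin.elim0 = 0 := by
      refine Measure.ext_of_singleton fun a => ?_
      simpa using h a
    exact IsProbabilityMeasure.ne_zero (π.act 0 Fin.elim0) h1
  obtain ⟨b, hb⟩ := exists_ne a
  set p : ℝ := (π.act 0 Fin.elim0).real {a} with hp
  have hp0 : 0 < p := ENNReal.toReal_pos ha (measure_ne_top _ _)
  let m : Fin A → ℝ := fun c => if c = b then B / p else 0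
  let ν := gaussianBandit x m v
  -- Only plays of `a` are charged; the first round alone then contributes `p * (B / p) = B`.
  let g : Fin A → ℝ := fun c => if c = a then B / p else 0
  have hBp : 0 ≤ B / p := by positivity
  refine ⟨m, le_trans ?_ (integral_sum_actions_le_regret π ν (t + 1) g b fun c => ?_)⟩
  · have hmono : ∫ h, g (h 0).1 ∂(historyLaw π ν (t + 1)) ≤
        ∫ h, ∑ i, g (h i).1 ∂(historyLaw π ν (t + 1)) := by
      refine integral_mono (integrable_actions π ν (t + 1) fun s => g (s 0))
        (integrable_actions π ν (t + 1) fun s => ∑ i, g (s i)) fun h => ?_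
      refine Finset.single_le_sum (f := fun i => g (h i).1) (fun i _ => ?_) (Finset.mem_univ 0)
      dsimp only [g]
      split_ifs <;> simp [hBp]
    refine le_trans (le_of_eq ?_) hmono
    have hg0 (c : Fin A) : 0 ≤ g c := by
      dsimp only [g]
      split_ifs <;> simp [hBp]
    rw [integral_eq_lintegral_of_nonneg_ae (.of_forall fun h => hg0 _)
      (integrable_actions π ν (t + 1) fun s => g (s 0)).aestronglyMeasurable,
      lintegral_first_action π ν t fun c => ENNReal.ofReal (g c)]
    have hg (c : Fin A) : ENNReal.ofReal (g c) =
        Set.indicator {a} (fun _ => ENNReal.ofReal (B / p)) c := by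
      by_cases hc : c = a <;> simp [g, hc]
    simp_rw [hg]
    rw [lintegral_indicator_const (measurableSet_singleton a), ENNReal.toReal_mul,
      ENNReal.toReal_ofReal hBp]
    change B = B / p * p
    field_simp
  · rw [meanReward_gaussianBandit, meanReward_gaussianBandit]
    by_cases hcb : c = b
    · simp [m, g, hcb, hb]
    · by_cases hca : c = a <;> simp [m, g, hcb, hca, hBp, hb.symm]

/-- The expected number of times that action `a` is chosen in `T` rounds. -/
noncomputable def expectedCount {A : ℕ} (T : ℕ) (π : Policy A 𝒳) (ν : Bandit A 𝒳) (a : Fin A) :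
    ℝ :=
  ∫ h, ∑ t : Fin T, (if (h t).1 = a then (1 : ℝ) else 0) ∂(historyLaw π ν T)

/-- Pigeonhole: the expected counts sum to `T`, and `A - 1` actions differ from `b`. -/
theorem exists_expectedCount_le {A : ℕ} (T : ℕ) (hA : 2 ≤ A) (π : Policy A 𝒳) (ν : Bandit A 𝒳)
    (b : Fin A) : ∃ i, i ≠ b ∧ expectedCount T π ν i ≤ T / ((A : ℝ) - 1) := by
  have hcount (i : Fin A) : Integrable
      (fun h => ∑ t : Fin T, (if (h t).1 = i then (1 : ℝ) else 0)) (historyLaw π ν T) :=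
    integrable_actions π ν T fun s => ∑ t, if s t = i then (1 : ℝ) else 0
  have hA1 : (0 : ℝ) < (A : ℝ) - 1 := by
    have : (2 : ℝ) ≤ A := by exact_mod_cast hA
    linarith
  have hsum : ∑ i, expectedCount T π ν i = T := by
    simp only [expectedCount]
    rw [← integral_finsetSum _ fun i _ => hcount i]
    have h1 (h : Fin T → Round A 𝒳) :
        ∑ i, ∑ t : Fin T, (if (h t).1 = i then (1 : ℝ) else 0) = T := by
      rw [Finset.sum_comm]
      simp
    simp_rw [h1]
    simp
  have hb : 0 ≤ expectedCount T π ν b :=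
    integral_nonneg fun h => Finset.sum_nonneg fun t _ => by split_ifs <;> simp
  have hcard : ((Finset.univ.erase b).card : ℝ) = (A : ℝ) - 1 := by
    rw [Finset.card_erase_of_mem (Finset.mem_univ b), Finset.card_univ, Fintype.card_fin,
      Nat.cast_sub (by omega), Nat.cast_one]
  have hne : (Finset.univ.erase b).Nonempty := by
    have : Nontrivial (Fin A) := Fin.nontrivial_iff_two_le.2 hA
    obtain ⟨a, ha⟩ := exists_ne b
    exact ⟨a, by simp [ha]⟩
  obtain ⟨i, hi, hle⟩ := Finset.exists_le_of_sum_le (s := Finset.univ.erase b)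
    (f := expectedCount T π ν) (g := fun _ => T / ((A : ℝ) - 1)) hne (by
      rw [Finset.sum_const, nsmul_eq_mul, hcard, mul_div_cancel₀ _ hA1.ne', ← hsum,
        ← Finset.add_sum_erase _ _ (Finset.mem_univ b)]
      linarith)
  exact ⟨i, Finset.ne_of_mem_erase hi, hle⟩

theorem exists_gaussianBandit_unitMeans_le_regret {A T : ℕ} (hA : 2 ≤ A) (hT : A - 1 ≤ T) (x : 𝒳)
    (π : Policy A 𝒳) :
    ∃ m : Fin A → ℝ, (∀ a, m a ∈ Set.Icc (0 : ℝ) 1) ∧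
      √((T : ℝ) * ((A : ℝ) - 1)) / 12 ≤ regret T π (gaussianBandit x m 1) := by
  have hA2 : (2 : ℝ) ≤ A := by exact_mod_cast hA
  have hA1 : (0 : ℝ) < (A : ℝ) - 1 := by linarith
  have hTA : (A : ℝ) - 1 ≤ T := by
    have : A ≤ T + 1 := by omega
    have : (A : ℝ) ≤ T + 1 := by exact_mod_cast this
    linarith
  have hT0 : (0 : ℝ) < T := hA1.trans_le hTA
  -- That is `√((A - 1) / T) / 2`, which makes the entropy bound `(2δ)² / 2 * (T / (A - 1))` equal
  -- to `1/2`. The hypothesis `A - 1 ≤ T` gives `2δ ≤ 1`, which keeps the means in `[0, 1]`.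
  set δ : ℝ := √((T : ℝ) * ((A : ℝ) - 1)) / (2 * T) with hδ
  have hδ0 : 0 ≤ δ := by positivity
  have hδsq : δ ^ 2 = ((A : ℝ) - 1) / (4 * T) := by
    rw [hδ, div_pow, Real.sq_sqrt (by positivity)]
    field_simp
    norm_num
  have hδ1 : δ ≤ 1 / 2 := by
    refine abs_le_of_sq_le_sq' ?_ (by norm_num) |>.2
    rw [hδsq, div_le_iff₀ (by positivity)]
    linarith
  let b : Fin A := ⟨0, by omega⟩
  let m : Fin A → ℝ := fun a => if a = b then δ else 0
  let ν := gaussianBandit x m 1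
  obtain ⟨i, hib, hi⟩ := exists_expectedCount_le T hA π ν b
  let m' : Fin A → ℝ := fun a => if a = i then 2 * δ else m a
  let ν' := gaussianBandit x m' 1
  -- The log-likelihood ratio of `ν'` to `ν` in one round: only plays of `i` distinguish the two
  -- bandits.
  let y : Round A 𝒳 → ℝ := fun r => if r.1 = i then 2 * δ * rew r.2 - (2 * δ) ^ 2 / 2 else 0
  let n : (Fin T → Round A 𝒳) → ℝ := fun h => ∑ t, if (h t).1 = b then (1 : ℝ) else 0
  have hyi (z : Outcome 𝒳) : y (i, z) = 2 * δ * rew z - (2 * δ) ^ 2 / 2 := if_pos rfl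
  have hy_of_ne {a : Fin A} (ha : a ≠ i) (z : Outcome 𝒳) : y (a, z) = 0 := if_neg ha
  have hrew := measurable_rew (𝒳 := 𝒳)
  have hy : Measurable y := Measurable.ite (measurableSet_eq_fun measurable_fst measurable_const)
    (by fun_prop) measurable_const
  have hmi : m i = 0 := if_neg hib
  have hyint (a : Fin A) : Integrable (fun z => y (a, z)) (ν a : Measure (Outcome 𝒳)) := by
    by_cases ha : a = i
    · subst ha
      simp_rw [hyi]
      exact ((integrable_rew_gaussianOutcome x _ _).const_mul _).sub (integrable_const _)
    · simp [hy_of_ne ha]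
  have hymean (a : Fin A) : ∫ z, y (a, z) ∂(ν a : Measure (Outcome 𝒳)) =
      -(2 * δ ^ 2) * if a = i then (1 : ℝ) else 0 := by
    by_cases ha : a = i
    · subst ha
      simp_rw [hyi]
      rw [coe_gaussianBandit,
        integral_sub ((integrable_rew_gaussianOutcome x _ _).const_mul _) (integrable_const _),
        integral_const_mul, integral_rew_gaussianOutcome, hmi]
      simp only [integral_const, probReal_univ, smul_eq_mul, if_true]
      ring
    · simp [hy_of_ne ha, ha]
  have hratio (a : Fin A) : (ν' a : Measure (Outcome 𝒳)) =
      (ν a : Measure (Outcome 𝒳)).withDensity fun z => ENNReal.ofReal (Real.exp (y (a, z))) := by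
    by_cases ha : a = i
    · subst ha
      simp_rw [hyi]
      rw [coe_gaussianBandit, coe_gaussianBandit, hmi, show m' a = 2 * δ from if_pos rfl]
      exact gaussianOutcome_eq_withDensity x (2 * δ)
    · simp_rw [hy_of_ne ha]
      rw [coe_gaussianBandit, coe_gaussianBandit, show m' a = m a from if_neg ha]
      simp
  have hlaw : historyLaw π ν' T = (historyLaw π ν T).withDensity
      fun h => ENNReal.ofReal (Real.exp (∑ t, y (h t))) := by
    rw [historyLaw_eq_withDensity π (ℓ := fun r => ENNReal.ofReal (Real.exp (y r)))
      (by fun_prop) hratio T]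
    congr 1
    ext h
    rw [Real.exp_sum, ENNReal.ofReal_prod_of_nonneg fun t _ => (Real.exp_pos _).le]
  have hY : -(1 / 2) ≤ ∫ h, ∑ t, y (h t) ∂(historyLaw π ν T) := by
    rw [integral_sum_rounds π ν T hy hyint]
    simp_rw [hymean, ← Finset.mul_sum]
    rw [integral_const_mul]
    change _ ≤ -(2 * δ ^ 2) * expectedCount T π ν i
    have := mul_le_mul_of_nonneg_left hi (by positivity : 0 ≤ 2 * δ ^ 2)
    have h2 : 2 * δ ^ 2 * (T / ((A : ℝ) - 1)) = 1 / 2 := by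
      rw [hδsq]
      field_simp
      norm_num
    linarith
  have hn : Measurable n := Finset.measurable_sum _ fun t _ =>
    (measurable_of_finite fun a : Fin A => if a = b then (1 : ℝ) else 0).comp
      (measurable_round t).fst
  have hmain := mul_add_integral_le_of_withDensity (n := n) (T := T)
    (Finset.measurable_sum _ fun t _ => hy.comp (measurable_round t))
    (integrable_sum_rounds π ν T hy hyint) hlaw hn
    (fun h => Finset.sum_nonneg fun t _ => by split_ifs <;> simp)
    (fun h => (Finset.sum_le_sum (g := fun _ => (1 : ℝ)) fun t _ => by
      split_ifs <;> simp).trans_eq (by simp))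
  -- Under `ν`, every round not spent on `b` costs `δ`.
  have hν : δ * ∫ h, (T - n h) ∂(historyLaw π ν T) ≤ regret T π ν := by
    rw [← integral_const_mul]
    refine le_trans (le_of_eq ?_) (integral_sum_actions_le_regret π ν T
      (fun a => δ * (1 - if a = b then (1 : ℝ) else 0)) b fun a => ?_)
    · refine integral_congr_ae (.of_forall fun h => ?_)
      simp only [n, ← Finset.mul_sum, Finset.sum_sub_distrib]
      simp
    · rw [meanReward_gaussianBandit, meanReward_gaussianBandit]
      by_cases ha : a = b <;> simp [m, ha]
  -- Under `ν'`, every round spent on `b` costs `2δ - δ = δ` relative to `i`; the losses from other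
  -- actions are dropped.
  have hν' : δ * ∫ h, n h ∂(historyLaw π ν' T) ≤ regret T π ν' := by
    rw [← integral_const_mul]
    refine le_trans (le_of_eq ?_) (integral_sum_actions_le_regret π ν' T
      (fun a => δ * if a = b then (1 : ℝ) else 0) i fun a => ?_)
    · refine integral_congr_ae (.of_forall fun h => ?_)
      simp only [n, ← Finset.mul_sum]
    · rw [meanReward_gaussianBandit, meanReward_gaussianBandit]
      by_cases ha : a = b
      · simp only [ha, m', m, if_true, if_neg hib.symm]
        linarith
      · by_cases hai : a = i
        · simp [m', hai, hib]
        · simp [m', m, ha, hai, hδ0]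
  have hsum : √((T : ℝ) * ((A : ℝ) - 1)) / 6 ≤ regret T π ν + regret T π ν' := by
    -- The testing bound with `E[Y] ≥ -1/2` leaves `δ T / 3`, and `δ T` is half the square root.
    have h1 : √((T : ℝ) * ((A : ℝ) - 1)) / 6 = δ * (T * (2 + 2 * -(1 / 2)) / 3) := by
      rw [hδ]
      field_simp
      norm_num
    rw [h1]
    refine le_trans ?_ (add_le_add hν hν')
    rw [← mul_add]
    refine mul_le_mul_of_nonneg_left (le_trans ?_ hmain) hδ0
    gcongr
    exact hY
  have hm (a : Fin A) : m a ∈ Set.Icc (0 : ℝ) 1 := by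
    dsimp only [m]
    split_ifs <;> constructor <;> linarith
  rcases le_or_gt (√((T : ℝ) * ((A : ℝ) - 1)) / 12) (regret T π ν) with h | h
  · exact ⟨m, hm, h⟩
  · refine ⟨m', fun a => ?_, by linarith⟩
    by_cases ha : a = i
    · simp only [m', ha, if_true]
      constructor <;> linarith
    · simp only [m', if_neg ha]
      exact hm a

theorem sqrt_div_sixteen_sqrt_exp_le {s : ℝ} :
    √s / (16 * √(Real.exp 1)) ≤ √s / 12 := by
  have h : 1 ≤ √(Real.exp 1) := Real.one_le_sqrt.2 (Real.one_le_exp zero_le_one)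
  gcongr
  linarith

theorem le_minimaxRegret {A : ℕ} {T : ℕ} {𝒞 : Set (Bandit A 𝒳)} {B : ℝ}
    (h : ∀ π : Policy A 𝒳, ∃ ν ∈ 𝒞, B ≤ regret T π ν) : (B : EReal) ≤ minimaxRegret T 𝒞 :=
  le_iInf fun π =>
    let ⟨ν, hν, hB⟩ := h π
    (EReal.coe_le_coe_iff.2 hB).trans (le_iSup₂ (f := fun ν _ => (regret T π ν : EReal)) ν hν)

theorem regret_nonneg {A : ℕ} (T : ℕ) (π : Policy A 𝒳) (ν : Bandit A 𝒳) :
    0 ≤ regret T π ν :=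
  integral_nonneg fun _ => Finset.sum_nonneg fun _ _ =>
    sub_nonneg.2 (le_ciSup (Set.finite_range _).bddAbove _)

end LowerBound

end MissingBandit

theorem theorem3 {k : ℕ} (𝒳 : Set (EuclideanSpace ℝ (Fin k))) (h𝒳 : 𝒳.Nonempty)
    (A T : ℕ) (hA : 1 ≤ A) (hT : A - 1 ≤ T)
    (σ : Fin A → ℝ) (hσ : ∀ a, 0 < σ a)
    (qmin : ℝ) (hq : qmin ∈ Set.Ioc (0 : ℝ) 1) :
    ((√((T : ℝ) * ((A : ℝ) - 1)) / (16 * √(Real.exp 1)) : ℝ) : EReal) ≤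
        MissingBandit.minimaxRegret T (MissingBandit.classC₁ 𝒳 σ) ∧
    ((√((T : ℝ) * ((A : ℝ) - 1)) / (16 * √(Real.exp 1)) : ℝ) : EReal) ≤
        MissingBandit.minimaxRegret T (MissingBandit.classC₂ 𝒳 σ qmin) ∧
    ((∀ a, 1 ≤ σ a) →
      ((√((T : ℝ) * ((A : ℝ) - 1)) / (16 * √(Real.exp 1)) : ℝ) : EReal) ≤
          MissingBandit.minimaxRegret T
            (MissingBandit.classC₁ 𝒳 σ ∩ MissingBandit.unitMeans A 𝒳) ∧
      ((√((T : ℝ) * ((A : ℝ) - 1)) / (16 * √(Real.exp 1)) : ℝ) : EReal) ≤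
          MissingBandit.minimaxRegret T
            (MissingBandit.classC₂ 𝒳 σ qmin ∩ MissingBandit.unitMeans A 𝒳)) := by
  open MissingBandit in
  obtain ⟨x₀, hx₀⟩ := h𝒳
  let x : 𝒳 := ⟨x₀, hx₀⟩
  let v : Fin A → NNReal := fun a => Real.toNNReal (σ a ^ 2)
  have hv (a : Fin A) : (v a : ℝ) ≤ σ a ^ 2 := (Real.coe_toNNReal _ (sq_nonneg _)).le
  have hgen (π : Policy A 𝒳) : ∃ m : Fin A → ℝ,
      √((T : ℝ) * ((A : ℝ) - 1)) / (16 * √(Real.exp 1)) ≤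
        regret T π (gaussianBandit x m v) := by
    -- For a single action the claimed bound is `0`.
    rcases hA.eq_or_lt with rfl | hA2
    · exact ⟨0, by simpa using regret_nonneg T π _⟩
    · exact exists_gaussianBandit_le_regret hA2 (by omega) x v π (by positivity)
  have hunit (π : Policy A 𝒳) : ∃ m : Fin A → ℝ, (∀ a, m a ∈ Set.Icc (0 : ℝ) 1) ∧
      √((T : ℝ) * ((A : ℝ) - 1)) / (16 * √(Real.exp 1)) ≤
        regret T π (gaussianBandit x m 1) := by
    rcases hA.eq_or_lt with rfl | hA2
    · exact ⟨0, by simp, by simpa using regret_nonneg T π _⟩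
    · obtain ⟨m, hm, h⟩ := exists_gaussianBandit_unitMeans_le_regret hA2 hT x π
      exact ⟨m, hm, sqrt_div_sixteen_sqrt_exp_le.trans h⟩
  refine ⟨le_minimaxRegret fun π => ?_, le_minimaxRegret fun π => ?_, fun hσ1 => ?_⟩
  · obtain ⟨m, h⟩ := hgen π
    exact ⟨_, gaussianBandit_mem_classC₁ x m v hv, h⟩
  · obtain ⟨m, h⟩ := hgen π
    exact ⟨_, gaussianBandit_mem_classC₂ x m v hv hq.2, h⟩
  -- Here `σ a ≥ 1` is what admits unit-variance rewards.
  · have hv1 (a : Fin A) : (((1 : Fin A → NNReal) a : NNReal) : ℝ) ≤ σ a ^ 2 := by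
      simpa using one_le_pow₀ (n := 2) (hσ1 a)
    refine ⟨le_minimaxRegret fun π => ?_, le_minimaxRegret fun π => ?_⟩
    all_goals obtain ⟨m, hm, h⟩ := hunit π
    · exact ⟨_, ⟨gaussianBandit_mem_classC₁ x m 1 hv1, gaussianBandit_mem_unitMeans x m 1 hm⟩, h⟩
    · exact ⟨_, ⟨gaussianBandit_mem_classC₂ x m 1 hv1 hq.2,
        gaussianBandit_mem_unitMeans x m 1 hm⟩, h⟩
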